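/- Let $K$ be an algebraically closed field, $G$ a connected semisimple linear algebraic group over $K$, $T$ a maximal torus of $G$ with character lattice $M$, and $W=N_G(T)/T$ the Weyl group. For $w\in W$ let $\varphi_w$ be the automorphism $\varphi_w(t)=n_w t n_w^{-1}$ of $T$, where $n_w\in N_G(T)$ is any representative of $w$; let $\Phi_w$ be the matrix, in a basis of $M$, of the induced map $\varphi_w^*\colon M\to M$, $\varphi_w^*\chi=\chi\circ\varphi_w$, and let $E$ be the identity matrix. The element $w$ is called elliptic if $\varphi_w^*$ has no non-zero fixed vector in $M\otimes_{\mathbb Z}\mathbb Q$. The multiplicity of an integer $k\times m$ matrix $C=(c_{ij})$ is the number of connected components (in the Zariski topology) of the kernel of the homomorphism $$\gamma_C\colon (K^\times)^k\to (K^\times)^m,\qquad (t_1,\dots,t_k)\mapsto\bigl(t_1^{c_{11}}\cdots t_k^{c_{k1}},\ \dots,\ t_1^{c_{1m}}\cdots t_k^{c_{km}}\bigr).$$ Let $w\in W$ be elliptic. Then, for every basis of $M$, the matrix $\Phi_w-E$ is nonsingular, the number $\tau(w)$ of fixed points of $\varphi_w$ in $T$ is finite, and $\tau(w)$ is equal to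 the multiplicity of $\Phi_w-E$. This multiplicity equals $|\det(\Phi_w-E)|$ if $\operatorname{char}K=0$, and it equals the $p'$-part of $|\det(\Phi_w-E)|$ (the quotient by the greatest power of $p$ dividing it) if $\operatorname{char}K=p>0$. -/

import Mathlib

open scoped Topology TensorProduct

namespace LinAlgGrp

noncomputable section

/-! Affine varieties over an algebraically closed field `K` are handled classically: a set of points
`X` together with its `K`-algebra `A` of regular functions `X → K`. -/

/-- The Zariski topology of `X`: the principal open sets `{x | f x ≠ 0}`, for `f` a regular
function, are a basis. -/
abbrev zariskiTopology {K X : Type*} [Field K] (A : Subalgebra K (X → K)) : TopologicalSpace X :=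
  TopologicalSpace.generateFrom {U | ∃ f ∈ A, U = {x | f x ≠ 0}}

/-- A map is regular (a morphism) if it pulls regular functions back to regular functions. -/
def IsRegularMap {K X Y : Type*} [Field K] (A : Subalgebra K (X → K)) (B : Subalgebra K (Y → K))
    (φ : X → Y) : Prop :=
  ∀ f ∈ B, f ∘ φ ∈ A

/-- The regular functions on a subgroup `H` of `GL_n(K)`: polynomials in the matrix entries and
the inverse of the determinant, restricted to `H`. -/
def regularGL {K : Type*} [Field K] {n : ℕ} (H : Subgroup (GL (Fin n) K)) :
    Subalgebra K (H → K) :=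
  Algebra.adjoin K
    ({f | ∃ i j, f = fun g : H => (g : GL (Fin n) K).val i j} ∪
      {fun g : H => ((g : GL (Fin n) K).val.det)⁻¹})

/-- The regular functions on `(K^×)^k`: the Laurent polynomials in the coordinates. -/
def regularTorus (K : Type*) [Field K] (k : ℕ) : Subalgebra K ((Fin k → Kˣ) → K) :=
  Algebra.adjoin K
    ({f | ∃ i, f = fun t => ((t i : Kˣ) : K)} ∪ {f | ∃ i, f = fun t => (((t i)⁻¹ : Kˣ) : K)})

/-- The Zariski topology of `GL_n(K)`. -/
abbrev zariskiGL (K : Type*) [Field K] (n : ℕ) : TopologicalSpace (GL (Fin n) K) :=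
  TopologicalSpace.induced (fun g => (⟨g, Subgroup.mem_top g⟩ : (⊤ : Subgroup (GL (Fin n) K))))
    (zariskiTopology (regularGL (⊤ : Subgroup (GL (Fin n) K))))

section Groups

variable {K : Type*} [Field K] {n : ℕ}

/-- `H` is Zariski closed in `GL_n(K)`, that is, `H` is a linear algebraic group. -/
def IsAlgebraic (H : Subgroup (GL (Fin n) K)) : Prop :=
  IsClosed[zariskiGL K n] (H : Set (GL (Fin n) K))

/-- `H` is connected in the Zariski topology. -/
def IsConn (H : Subgroup (GL (Fin n) K)) : Prop :=
  @IsConnected _ (zariskiGL K n) (H : Set (GL (Fin n) K))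

/-- `G` has trivial radical: its only closed connected solvable normal subgroup is trivial. -/
def HasTrivialRadical (G : Subgroup (GL (Fin n) K)) : Prop :=
  ∀ H : Subgroup (GL (Fin n) K), H ≤ G → IsAlgebraic H → IsConn H → (H.subgroupOf G).Normal →
    Group.IsSolvable H → H = ⊥

/-- `G` is a connected semisimple linear algebraic group. -/
structure IsConnectedSemisimple (G : Subgroup (GL (Fin n) K)) : Prop where
  isAlgebraic : IsAlgebraic G
  isConn : IsConn G
  hasTrivialRadical : HasTrivialRadical G

/-- `T` is a torus: a closed subgroup isomorphic, as an algebraic group, to some `(K^×)^k`. -/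
def IsTorus (T : Subgroup (GL (Fin n) K)) : Prop :=
  IsAlgebraic T ∧ ∃ (k : ℕ) (e : T ≃* (Fin k → Kˣ)),
    IsRegularMap (regularGL T) (regularTorus K k) e ∧
    IsRegularMap (regularTorus K k) (regularGL T) e.symm

/-- `T` is a maximal torus of `G`. -/
structure IsMaximalTorus (G T : Subgroup (GL (Fin n) K)) : Prop where
  le : T ≤ G
  isTorus : IsTorus T
  eq_of_le : ∀ S : Subgroup (GL (Fin n) K), S ≤ G → IsTorus S → T ≤ S → S = T

/-- The character lattice of `T`, written additively: the homomorphisms of algebraic groups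
`χ : T → K^×`, i.e. those for which the pullbacks `χ` and `χ⁻¹` of the generators `x` and `x⁻¹` of
the algebra of regular functions on `K^×` are regular. -/
def characterLattice (T : Subgroup (GL (Fin n) K)) : AddSubgroup (Additive (T →* Kˣ)) where
  carrier := {χ |
    (fun t => ((χ.toMul t : Kˣ) : K)) ∈ regularGL T ∧
    (fun t => (((χ.toMul t)⁻¹ : Kˣ) : K)) ∈ regularGL T}
  zero_mem' := by
    have h : (fun _ => 1 : T → K) ∈
      regularGL T := one_mem _
    constructor
    · simpa using h
    · simpa using h
  add_mem' := by
    rintro χ ψ ⟨h1, h2⟩ ⟨h3, h4⟩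
    constructor
    · convert mul_mem h1 h3 using 1
      ext t
      simp
    · convert mul_mem h2 h4 using 1
      ext t
      simp [mul_comm]
  neg_mem' := by
    rintro χ ⟨h1, h2⟩
    constructor
    · simpa using h2
    · simpa using h1

/-- For an endomorphism `φ` of the algebraic group `T`, the induced map `φ^* χ = χ ∘ φ` of the
character lattice. -/
def pullback {T : Subgroup (GL (Fin n) K)} (φ : T →* T)
    (hφ : IsRegularMap (regularGL T) (regularGL T) φ) :
    characterLattice T →ₗ[ℤ] characterLattice T :=
  AddMonoidHom.toIntLinearMap
    { toFun := fun χ =>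
        ⟨Additive.ofMul (χ.1.toMul.comp φ), hφ _ χ.2.1, hφ _ χ.2.2⟩
      map_zero' := rfl
      map_add' := fun _ _ => rfl }

/-- The normalizer `N_G(T)`. -/
def normalizerIn (G T : Subgroup (GL (Fin n) K)) : Subgroup (GL (Fin n) K) :=
  G ⊓ Subgroup.normalizer (T : Set (GL (Fin n) K))

instance normal_subgroupOf_normalizerIn (G T : Subgroup (GL (Fin n) K)) :
    (T.subgroupOf (normalizerIn G T)).Normal where
  conj_mem := fun t ht g => (g.2.2 (t : GL (Fin n) K)).1 ht

/-- The Weyl group `W = N_G(T) / T`. -/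
abbrev WeylGroup (G T : Subgroup (GL (Fin n) K)) : Type _ :=
  normalizerIn G T ⧸ T.subgroupOf (normalizerIn G T)

/-- Conjugation `t ↦ g t g⁻¹` of `T` by elements `g` of `N_G(T)`. -/
def conjHom (G T : Subgroup (GL (Fin n) K)) : normalizerIn G T →* MulAut T :=
  T.normalizerMonoidHom.comp (Subgroup.inclusion inf_le_right)

theorem conjHom_apply (G T : Subgroup (GL (Fin n) K)) (g : normalizerIn G T) (t : T) :
    ((conjHom G T g t : T) : GL (Fin n) K) = g * t * (g : GL (Fin n) K)⁻¹ := rfl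

theorem IsTorus.commute {T : Subgroup (GL (Fin n) K)} (hT : IsTorus T) (s t : T) :
    s * t = t * s := by
  obtain ⟨-, k, e, -⟩ := hT
  apply e.injective
  rw [map_mul, map_mul, mul_comm]

/-- The action `w ↦ φ_w` of the Weyl group on the torus: `φ_w(t) = g t g⁻¹`, where `g` is
any representative of `w` in `N_G(T)`. -/
def weylAut {G T : Subgroup (GL (Fin n) K)} (hT : IsTorus T) : WeylGroup G T →* MulAut T :=
  QuotientGroup.lift (T.subgroupOf (normalizerIn G T)) (conjHom G T) (by
    intro g hg
    refine MulEquiv.ext fun t => Subtype.ext ?_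
    have h := congrArg Subtype.val
      (hT.commute (⟨(g : GL (Fin n) K), Subgroup.mem_subgroupOf.1 hg⟩ : T) t)
    rw [conjHom_apply]
    exact mul_inv_eq_of_eq_mul h)

theorem weylAut_mk {G T : Subgroup (GL (Fin n) K)} (hT : IsTorus T) (g : normalizerIn G T)
    (t : T) : ((weylAut hT (g : WeylGroup G T) t : T) : GL (Fin n) K) =
      g * t * (g : GL (Fin n) K)⁻¹ := rfl

theorem isRegularMap_weylAut {G T : Subgroup (GL (Fin n) K)} (hT : IsTorus T)
    (w : WeylGroup G T) :
    IsRegularMap (regularGL T) (regularGL T)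
      (weylAut hT w) := by
  induction w using QuotientGroup.induction_on with
  | H g =>
    intro f hf
    induction hf using Algebra.adjoin_induction with
    | mem f hf =>
      rcases hf with ⟨i, j, rfl⟩ | rfl
      · have h : ((fun t : T => (t : GL (Fin n) K).val i j) ∘
            (weylAut hT (g : WeylGroup G T)) : T → K) =
            ∑ b, ∑ a, ((g : GL (Fin n) K).val i a * ((g : GL (Fin n) K)⁻¹).val b j) •
              (fun t : T => (t : GL (Fin n) K).val a b) := by
          ext t
          simp only [Function.comp_apply, weylAut_mk, Units.val_mul, Matrix.mul_apply,
            Finset.sum_apply, Pi.smul_apply, smul_eq_mul, Finset.sum_mul]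
          refine Finset.sum_congr rfl fun b _ => Finset.sum_congr rfl fun a _ => ?_
          ring
        rw [h]
        refine sum_mem fun b _ => sum_mem fun a _ => ?_
        refine Subalgebra.smul_mem (regularGL T) ?_ _
        exact Algebra.subset_adjoin (Or.inl ⟨a, b, rfl⟩)
      · have h : ((fun t : T => ((t : GL (Fin n) K).val.det)⁻¹) ∘
            (weylAut hT (g : WeylGroup G T)) : T → K) =
            (fun t : T => ((t : GL (Fin n) K).val.det)⁻¹) := by
          ext t
          simp only [Function.comp_apply, weylAut_mk, Units.val_mul]
          rw [Matrix.det_units_conj]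
        rw [h]
        exact Algebra.subset_adjoin (Or.inr rfl)
    | algebraMap r => exact Subalgebra.algebraMap_mem _ r
    | add f₁ f₂ _ _ h₁ h₂ => exact add_mem h₁ h₂
    | mul f₁ f₂ _ _ h₁ h₂ => exact mul_mem h₁ h₂

/-- The operator `φ_w^*` on the character lattice `M` of `T`. -/
def weylOp {G T : Subgroup (GL (Fin n) K)} (hT : IsTorus T) (w : WeylGroup G T) :
    characterLattice T →ₗ[ℤ] characterLattice T :=
  pullback (weylAut hT w).toMonoidHom (isRegularMap_weylAut hT w)

/-- `σ(w)`: the dimension of the space of `w`-fixed vectors in `M_ℚ = ℚ ⊗ M`. -/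
def fixedDim {G T : Subgroup (GL (Fin n) K)} (hT : IsTorus T) (w : WeylGroup G T) : Cardinal :=
  Module.rank ℚ (LinearMap.ker ((weylOp hT w).baseChange ℚ - LinearMap.id))

/-- `w` is elliptic if `σ(w) = 0`. -/
def IsElliptic {G T : Subgroup (GL (Fin n) K)} (hT : IsTorus T) (w : WeylGroup G T) : Prop :=
  fixedDim hT w = 0

/-- The matrix `Φ_w` of the operator `φ_w^*` in a basis of the character lattice. -/
def weylMatrix {G T : Subgroup (GL (Fin n) K)} (hT : IsTorus T) (w : WeylGroup G T) {r : ℕ}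
    (b : Module.Basis (Fin r) ℤ (characterLattice T)) : Matrix (Fin r) (Fin r) ℤ :=
  LinearMap.toMatrix b b (weylOp hT w)

/-- The set of fixed points of `φ_w` in `T`. -/
def fixedPoints {G T : Subgroup (GL (Fin n) K)} (hT : IsTorus T) (w : WeylGroup G T) : Set T :=
  {t | weylAut hT w t = t}

end Groups

/-- The homomorphism `γ_C : (K^×)^k → (K^×)^m` of an integer `k × m` matrix `C`, whose `j`-th
coordinate is `t₁ ^ c₁ⱼ ⋯ tₖ ^ cₖⱼ`. -/
def torusHom (K : Type*) [Field K] {k m : ℕ} (C : Matrix (Fin k) (Fin m) ℤ) :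
    (Fin k → Kˣ) →* (Fin m → Kˣ) where
  toFun t j := ∏ i, t i ^ C i j
  map_one' := by
    ext j
    simp
  map_mul' s t := by
    ext j
    simp [mul_zpow, Finset.prod_mul_distrib]

/-- The multiplicity of `C` over `K`: the number of connected components of the kernel of
`γ_C` in the Zariski topology. -/
def matrixMultiplicity (K : Type*) [Field K] {k m : ℕ} (C : Matrix (Fin k) (Fin m) ℤ) : ℕ :=
  letI : TopologicalSpace (Fin k → Kˣ) := zariskiTopology (regularTorus K k)
  Nat.card (ConnectedComponents (torusHom K C).ker)

/-- The `p'`-part of a natural number: the quotient by its greatest `p`-power divisor. -/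
def primeToPart (p m : ℕ) : ℕ := m / p ^ padicValNat p m

end

end LinAlgGrp

/-! For a basis `b` of the character lattice of `T`, the map `t ↦ (b i t)` is a bijection of `T`
onto `(K^×)^r` (`characterMap_bijective`): every regular character of `(K^×)^k` is a Laurent
monomial, by the linear independence of characters. Through this bijection the equation
`φ_w(t) = t` becomes `γ_C(t) = 1` for `C = Φ_w - 1` (`weylAut_eq_self_iff`), so the fixed points
of `φ_w` correspond to the kernel of `γ_C`. Ellipticity says that `C` is injective over `ℚ`, so
`det C ≠ 0`.

The kernel of `γ_C` is the group of homomorphisms into `K^×` from the cokernel `ℤ^r / C ℤ^r`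
(`kerTorusHomEquiv`), a finite abelian group of order `|det C|`. Splitting it into cyclic groups
`ℤ/n` reduces the count to `n`-th roots of unity in `K`, of which there are as many as the
`p'`-part of `n`, where `p` is the characteristic exponent of `K` (`card_addMonoidHom_units`).
Finally, points are Zariski closed, so this finite kernel is discrete and the number of its
connected components is its cardinality (`matrixMultiplicity_eq_card_ker`). -/

namespace LinAlgGrp

/-! ### Characters of the standard torus -/

/-- The Laurent monomial `t ↦ ∏ i, t i ^ m i`, as a homomorphism `(K^×)^k → K`. -/
def laurentMonomial (K : Type*) [Field K] {k : ℕ} (m : Fin k → ℤ) : (Fin k → Kˣ) →* K where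
  toFun t := ((∏ i, t i ^ m i : Kˣ) : K)
  map_one' := by simp
  map_mul' s t := by simp [mul_zpow, Finset.prod_mul_distrib]

theorem regularTorus_le_span_laurentMonomial (K : Type*) [Field K] (k : ℕ) :
    Subalgebra.toSubmodule (regularTorus K k) ≤
      Submodule.span K ((fun f : (Fin k → Kˣ) →* K => (f : (Fin k → Kˣ) → K)) ''
        Set.range (laurentMonomial K)) := by
  rw [regularTorus, Algebra.adjoin_eq_span]
  refine Submodule.span_mono fun f hf => ?_
  induction hf using Submonoid.closure_induction with
  | mem f hf =>
    rcases hf with ⟨i, rfl⟩ | ⟨i, rfl⟩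
    · refine ⟨_, ⟨Pi.single i 1, rfl⟩, ?_⟩
      ext t
      simp [laurentMonomial, Pi.single_apply]
    · refine ⟨_, ⟨Pi.single i (-1), rfl⟩, ?_⟩
      ext t
      change ((∏ j, t j ^ (Pi.single i (-1) : Fin k → ℤ) j : Kˣ) : K) = _
      rw [Finset.prod_eq_single i (fun j _ hj => by simp [hj]) (by simp)]
      simp
  | one => exact ⟨_, ⟨0, rfl⟩, by ext t; simp [laurentMonomial]⟩
  | mul f g _ _ hf hg =>
    obtain ⟨_, ⟨m, rfl⟩, rfl⟩ := hf
    obtain ⟨_, ⟨m', rfl⟩, rfl⟩ := hg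
    refine ⟨_, ⟨m + m', rfl⟩, ?_⟩
    ext t
    simp [laurentMonomial, zpow_add, Finset.prod_mul_distrib]

/-- A regular character of the standard torus is a linear combination of Laurent monomials, hence,
by the linear independence of characters, it is one of them. -/
theorem exists_eq_prod_zpow_of_mem_regularTorus {K : Type*} [Field K] {k : ℕ}
    (χ : (Fin k → Kˣ) →* Kˣ) (hχ : (fun t => ((χ t : Kˣ) : K)) ∈ regularTorus K k) :
    ∃ m : Fin k → ℤ, ∀ t, χ t = ∏ i, t i ^ m i := by
  by_contra h
  have hχ' : (Units.coeHom K).comp χ ∉ Set.range (laurentMonomial (k := k) K) := by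
    rintro ⟨m, hm⟩
    exact h ⟨m, fun t => Units.ext (DFunLike.congr_fun hm t).symm⟩
  exact (linearIndependent_monoidHom (Fin k → Kˣ) K).notMem_span_image hχ'
    (regularTorus_le_span_laurentMonomial K k hχ)

/-! ### Coordinates on a torus given by a basis of its character lattice -/

section Coordinates

variable {K : Type*} [Field K] {n : ℕ} {T : Subgroup (GL (Fin n) K)}

/-- Evaluation of the characters of `T` at a point. -/
def evalCharacter (t : T) : characterLattice T →ₗ[ℤ] Additive Kˣ :=
  AddMonoidHom.toIntLinearMap
    { toFun := fun χ => Additive.ofMul (χ.1.toMul t)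
      map_zero' := rfl
      map_add' := fun _ _ => rfl }

/-- The homomorphism `T → (K^×)^r` whose coordinates are the members of a family of characters. -/
def characterMap {r : ℕ} (b : Fin r → characterLattice T) : T →* (Fin r → Kˣ) :=
  MonoidHom.pi fun i => (b i).1.toMul

theorem evalCharacter_apply (t : T) (χ : characterLattice T) :
    (evalCharacter t χ).toMul = χ.1.toMul t := rfl

theorem apply_eq_prod_characterMap {r : ℕ} (b : Module.Basis (Fin r) ℤ (characterLattice T))
    (χ : characterLattice T) (t : T) :
    χ.1.toMul t = ∏ i, characterMap b t i ^ b.repr χ i := by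
  conv_lhs => rw [← evalCharacter_apply, ← b.sum_repr χ, map_sum, toMul_sum]
  refine Finset.prod_congr rfl fun i _ => ?_
  rw [map_zsmul, toMul_zsmul]
  rfl

/-- A basis of the character lattice identifies the torus with `(K^×)^r`. -/
theorem characterMap_bijective (hT : IsTorus T) {r : ℕ}
    (b : Module.Basis (Fin r) ℤ (characterLattice T)) :
    Function.Bijective (characterMap b) := by
  obtain ⟨-, k, e, he, he'⟩ := hT
  let X : Fin k → characterLattice T := fun j =>
    ⟨Additive.ofMul ((Pi.evalMonoidHom (fun _ => Kˣ) j).comp e.toMonoidHom),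
      he _ (Algebra.subset_adjoin (Or.inl ⟨j, rfl⟩)),
      he _ (Algebra.subset_adjoin (Or.inr ⟨j, rfl⟩))⟩
  have hX (j : Fin k) (t : T) : (X j).1.toMul t = e t j := rfl
  constructor
  · intro s t hst
    refine e.injective (funext fun j => ?_)
    rw [← hX, ← hX, apply_eq_prod_characterMap b, apply_eq_prod_characterMap b, hst]
  · intro u
    -- The prescribed values of the basis extend to a homomorphism on the whole lattice; its values
    -- at the coordinate characters are the coordinates of the required point.
    let F : characterLattice T →ₗ[ℤ] Additive Kˣ := b.constr ℤ fun i => Additive.ofMul (u i)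
    refine ⟨e.symm fun j => (F (X j)).toMul, funext fun i => ?_⟩
    obtain ⟨m, hm⟩ := exists_eq_prod_zpow_of_mem_regularTorus
      ((b i).1.toMul.comp e.symm.toMonoidHom) (he' _ (b i).2.1)
    have hb : b i = ∑ j, m j • X j := by
      refine Subtype.ext (Additive.toMul.injective (MonoidHom.ext fun t => ?_))
      have h := hm (e t)
      rw [← evalCharacter_apply, ← evalCharacter_apply, map_sum, toMul_sum]
      simp only [map_zsmul, toMul_zsmul, evalCharacter_apply, hX]
      simpa using h
    have hF : F (b i) = Additive.ofMul (u i) := b.constr_basis ℤ _ i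
    rw [hb, map_sum] at hF
    refine (hm _).trans (Eq.trans ?_ (congrArg Additive.toMul hF))
    simp [toMul_sum]

end Coordinates

/-! ### The number of homomorphisms from a finite abelian group to `K^×` -/

theorem primeToPart_one_left (m : ℕ) : primeToPart 1 m = m := by
  simp [primeToPart]

/-- For a characteristic exponent `p`, `1` included, the `p'`-part is Mathlib's `ordCompl[p]`. -/
theorem primeToPart_eq_ordCompl (K : Type*) [Field K] (p m : ℕ) [ExpChar K p] :
    primeToPart p m = ordCompl[p] m := by
  cases ‹ExpChar K p› with
  | zero => simp [primeToPart]
  | prime hp => rw [primeToPart, Nat.factorization_def m hp]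

section Dual

variable (K : Type*) [Field K]

/-- Homomorphisms from a finite cyclic group correspond to roots of unity. -/
noncomputable def zmodHomEquivRootsOfUnity (n : ℕ) : (ZMod n →+ Additive Kˣ) ≃ rootsOfUnity n K :=
  (ZMod.lift n).symm.trans <|
    ((zmultiplesHom (Additive Kˣ)).symm.trans Additive.toMul).subtypeEquiv fun f => by
      have h : f n = n • f 1 := by rw [← map_nsmul]; simp
      rw [h, mem_rootsOfUnity]
      exact Iff.rfl

variable [IsAlgClosed K] (p : ℕ) [ExpChar K p]

/-- Taking `p`-th powers is injective on `K^×`, so the `p`-part of `n` does not contribute. -/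
theorem card_rootsOfUnity_eq_primeToPart {n : ℕ} (hn : n ≠ 0) :
    Nat.card (rootsOfUnity n K) = primeToPart p n := by
  rw [primeToPart_eq_ordCompl K p n]
  have hcast : NeZero ((ordCompl[p] n : ℕ) : K) := by
    constructor
    cases ‹ExpChar K p› with
    | zero => simpa using hn
    | prime hp =>
      rw [Ne, CharP.cast_eq_zero_iff K p]
      exact Nat.not_dvd_ordCompl hp hn
  have : NeZero (ordCompl[p] n) := .of_neZero_natCast K
  have h : rootsOfUnity n K = rootsOfUnity (ordCompl[p] n) K := by
    ext ζ
    conv_lhs => rw [← Nat.ordProj_mul_ordCompl_eq_self n p]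
    exact mem_rootsOfUnity_prime_pow_mul_iff K p _ _
  rw [h, HasEnoughRootsOfUnity.natCard_rootsOfUnity]

/-- For `p = 1` this says that a finite abelian group and its dual have the same order; in
characteristic `p` the `p`-primary part of `A` has no non-trivial homomorphism to `K^×`. -/
theorem card_addMonoidHom_units (A : Type*) [AddCommGroup A] [Finite A] :
    Nat.card (A →+ Additive Kˣ) = primeToPart p (Nat.card A) := by
  classical
  obtain ⟨ι, _, n, hn, ⟨e⟩⟩ := AddCommGroup.equiv_directSum_zmod_of_finite' A
  have hhom : (A →+ Additive Kˣ) ≃ ∀ i, rootsOfUnity (n i) K :=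
    (e.addMonoidHomCongrLeftEquiv (N := Additive Kˣ)).trans <|
      (DFinsupp.liftAddHom (β := fun i => ZMod (n i)) (γ := Additive Kˣ)).symm.toEquiv.trans <|
        Equiv.piCongrRight fun i => zmodHomEquivRootsOfUnity K (n i)
  have hmul (a c : ℕ) : primeToPart p (a * c) = primeToPart p a * primeToPart p c := by
    simp only [primeToPart_eq_ordCompl K, Nat.ordCompl_mul]
  have hone : primeToPart p 1 = 1 := by simp [primeToPart]
  let f : ℕ →* ℕ := { toFun := primeToPart p, map_one' := hone, map_mul' := hmul }
  have hA : Nat.card A = ∏ i, n i := by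
    rw [Nat.card_congr (e.toEquiv.trans (DirectSum.addEquivProd _).toEquiv), Nat.card_pi]
    simp
  rw [Nat.card_congr hhom, Nat.card_pi, hA]
  refine Eq.trans (Finset.prod_congr rfl fun i _ => ?_) (map_prod f n _).symm
  exact card_rootsOfUnity_eq_primeToPart K p (by have := hn i; omega)

end Dual

/-! ### Kernels of monomial homomorphisms -/

section Kernel

variable (K : Type*) [Field K]

/-- Extending a point `t` of `(K^×)^k` to a homomorphism `ℤ^k → K^×`, the coordinates of `γ_C t`
are its values at the columns of `C`. -/
theorem constr_mulVec_single {k m : ℕ} (C : Matrix (Fin k) (Fin m) ℤ) (t : Fin k → Kˣ)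
    (j : Fin m) :
    (Pi.basisFun ℤ (Fin k)).constr ℤ (fun i => Additive.ofMul (t i))
      (C.mulVecLin (Pi.single j 1)) = Additive.ofMul (torusHom K C t j) := by
  rw [Module.Basis.constr_apply_fintype]
  simp [torusHom]

/-- The kernel of `γ_C` is dual to the cokernel of `C`. -/
noncomputable def kerTorusHomEquiv {k m : ℕ} (C : Matrix (Fin k) (Fin m) ℤ) :
    (torusHom K C).ker ≃ (((Fin k → ℤ) ⧸ LinearMap.range C.mulVecLin) →+ Additive Kˣ) where
  toFun t := ((LinearMap.range C.mulVecLin).liftQ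
    ((Pi.basisFun ℤ (Fin k)).constr ℤ fun i => Additive.ofMul (t.1 i)) <| by
      rw [LinearMap.range_le_ker_iff]
      refine (Pi.basisFun ℤ (Fin m)).ext fun j => ?_
      have h := congrFun (MonoidHom.mem_ker.1 t.2) j
      simp only [Pi.basisFun_apply, LinearMap.comp_apply]
      rw [constr_mulVec_single, h]
      rfl).toAddMonoidHom
  invFun f := ⟨fun i => (f (Submodule.Quotient.mk (Pi.single i 1))).toMul, by
    refine MonoidHom.mem_ker.2 (funext fun j => Additive.ofMul.injective ?_)
    have hf : (Pi.basisFun ℤ (Fin k)).constr ℤ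
        (fun i => f (Submodule.Quotient.mk (Pi.single i 1))) =
        f.toIntLinearMap.comp (LinearMap.range C.mulVecLin).mkQ :=
      (Pi.basisFun ℤ (Fin k)).ext fun i => by
        rw [Module.Basis.constr_basis]
        simp
    rw [← constr_mulVec_single]
    simp only [ofMul_toMul]
    rw [hf, LinearMap.comp_apply, Submodule.mkQ_apply,
      (Submodule.Quotient.mk_eq_zero _).2 (LinearMap.mem_range_self _ _), map_zero]
    rfl⟩
  left_inv t := by
    refine Subtype.ext (funext fun i => ?_)
    have h := (Pi.basisFun ℤ (Fin k)).constr_basis ℤ (fun i => Additive.ofMul (t.1 i)) i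
    rw [Pi.basisFun_apply] at h
    exact congrArg Additive.toMul h
  right_inv f := by
    refine AddMonoidHom.toIntLinearMap_injective ?_
    refine Submodule.linearMap_qext _ ((Pi.basisFun ℤ (Fin k)).ext fun i => ?_)
    have h := (Pi.basisFun ℤ (Fin k)).constr_basis ℤ
      (fun i => f (Submodule.Quotient.mk (Pi.single i 1))) i
    rw [Pi.basisFun_apply] at h ⊢
    exact h

theorem card_quotient_range_mulVecLin {r : ℕ} (C : Matrix (Fin r) (Fin r) ℤ) (hC : C.det ≠ 0) :
    Nat.card ((Fin r → ℤ) ⧸ LinearMap.range C.mulVecLin) = C.det.natAbs := by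
  have hinj : Function.Injective C.mulVecLin := Matrix.mulVec_injective_of_det_ne_zero hC
  rw [← Submodule.natAbs_det_equiv _ (LinearEquiv.ofInjective C.mulVecLin hinj)]
  congr 1
  exact LinearMap.det_toLin' C

/-- The points of `(K^×)^k` are closed, hence a finite kernel has the discrete topology. -/
theorem matrixMultiplicity_eq_card_ker {k m : ℕ} (C : Matrix (Fin k) (Fin m) ℤ)
    [Finite (torusHom K C).ker] :
    matrixMultiplicity K C = Nat.card (torusHom K C).ker := by
  let _ : TopologicalSpace (Fin k → Kˣ) := zariskiTopology (regularTorus K k)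
  have : T1Space (Fin k → Kˣ) := by
    refine t1Space_iff_exists_open.2 fun s t hst => ?_
    obtain ⟨i, hi⟩ := Function.ne_iff.1 hst
    refine ⟨{x | (x i : K) - t i ≠ 0}, TopologicalSpace.isOpen_generateFrom_of_mem
      ⟨fun x => (x i : K) - t i, ?_, rfl⟩, ?_, by simp⟩
    · exact sub_mem (Algebra.subset_adjoin (Or.inl ⟨i, rfl⟩))
        (Subalgebra.algebraMap_mem (regularTorus K k) (t i : K))
    · simpa [sub_eq_zero, Units.ext_iff] using hi
  exact Nat.card_congr (Equiv.ofBijective (ConnectedComponents.mk)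
    ⟨fun x y h => by simpa using ConnectedComponents.coe_eq_coe.1 h,
      ConnectedComponents.surjective_coe⟩).symm

variable [IsAlgClosed K] (p : ℕ) [ExpChar K p]

theorem card_ker_torusHom {r : ℕ} (C : Matrix (Fin r) (Fin r) ℤ) (hC : C.det ≠ 0) :
    Nat.card (torusHom K C).ker = primeToPart p C.det.natAbs := by
  have hcard := card_quotient_range_mulVecLin C hC
  have : Finite ((Fin r → ℤ) ⧸ LinearMap.range C.mulVecLin) :=
    Nat.finite_of_card_ne_zero (by rwa [hcard, Int.natAbs_ne_zero])
  rw [Nat.card_congr (kerTorusHomEquiv K C), card_addMonoidHom_units K p, hcard]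

theorem finite_ker_torusHom {r : ℕ} (C : Matrix (Fin r) (Fin r) ℤ) (hC : C.det ≠ 0) :
    Finite (torusHom K C).ker := by
  -- `Nat.card` is `0` on infinite types, and the `p'`-part of a positive number is positive.
  refine Nat.finite_of_card_ne_zero ?_
  rw [card_ker_torusHom K (ringExpChar K) C hC, primeToPart_eq_ordCompl K]
  exact (Nat.ordCompl_pos _ (Int.natAbs_ne_zero.2 hC)).ne'

end Kernel

/-! ### Elliptic elements -/

section Elliptic

variable {K : Type*} [Field K] {n : ℕ} {G T : Subgroup (GL (Fin n) K)}

theorem toMatrix_weylOp_sub_id (hT : IsTorus T) (w : WeylGroup G T) {r : ℕ}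
    (b : Module.Basis (Fin r) ℤ (characterLattice T)) :
    LinearMap.toMatrix b b (weylOp hT w - LinearMap.id) = weylMatrix hT w b - 1 := by
  rw [map_sub, LinearMap.toMatrix_id, weylMatrix]

/-- For elliptic `w` the operator `φ_w^* - 1` is injective over `ℚ`. -/
theorem det_weylMatrix_sub_one_ne_zero (hT : IsTorus T) {w : WeylGroup G T}
    (hw : IsElliptic hT w) {r : ℕ} (b : Module.Basis (Fin r) ℤ (characterLattice T)) :
    (weylMatrix hT w b - 1).det ≠ 0 := by
  have : Module.Free ℤ (characterLattice T) := .of_basis b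
  have : Module.Finite ℤ (characterLattice T) := .of_basis b
  rw [← toMatrix_weylOp_sub_id, LinearMap.det_toMatrix]
  intro h
  have hbase : (weylOp hT w).baseChange ℚ - LinearMap.id =
      (weylOp hT w - LinearMap.id).baseChange ℚ := by
    rw [LinearMap.baseChange_sub, LinearMap.baseChange_id]
  have hdet : LinearMap.det ((weylOp hT w).baseChange ℚ - LinearMap.id) = 0 := by
    rw [hbase, LinearMap.det_baseChange, h, map_zero]
  exact LinearMap.det_eq_zero_iff_ker_ne_bot.1 hdet (Submodule.rank_eq_zero.1 hw)

/-- In the coordinates given by a basis of the character lattice, the equation `φ_w(t) = t` is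
`γ_C(t) = 1` for `C = Φ_w - 1`. -/
theorem weylAut_eq_self_iff (hT : IsTorus T) (w : WeylGroup G T) {r : ℕ}
    (b : Module.Basis (Fin r) ℤ (characterLattice T)) (t : T) :
    weylAut hT w t = t ↔ characterMap b t ∈ (torusHom K (weylMatrix hT w b - 1)).ker := by
  rw [← (characterMap_bijective hT b).injective.eq_iff, MonoidHom.mem_ker, funext_iff, funext_iff]
  refine forall_congr' fun j => ?_
  have h : torusHom K (weylMatrix hT w b - 1) (characterMap b t) j =
      characterMap b (weylAut hT w t) j / characterMap b t j := by
    have hdiff := apply_eq_prod_characterMap b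
      ((weylOp hT w - LinearMap.id : characterLattice T →ₗ[ℤ] characterLattice T) (b j)) t
    simp only [← LinearMap.toMatrix_apply b b, toMatrix_weylOp_sub_id] at hdiff
    rw [← evalCharacter_apply, LinearMap.sub_apply, map_sub, toMul_sub] at hdiff
    exact hdiff.symm
  rw [h, Pi.one_apply, div_eq_one]

/-- The fixed points of `φ_w` are in bijection with the kernel of `γ_C` for `C = Φ_w - 1`. -/
noncomputable def fixedPointsEquivKer (hT : IsTorus T) (w : WeylGroup G T) {r : ℕ}
    (b : Module.Basis (Fin r) ℤ (characterLattice T)) :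
    fixedPoints hT w ≃ (torusHom K (weylMatrix hT w b - 1)).ker :=
  (Equiv.ofBijective _ (characterMap_bijective hT b)).subtypeEquiv (weylAut_eq_self_iff hT w b)

end Elliptic

end LinAlgGrp

theorem mainTheorem5 {K : Type*} [Field K] [IsAlgClosed K] {n : ℕ}
    (G T : Subgroup (GL (Fin n) K)) (_hG : LinAlgGrp.IsConnectedSemisimple G)
    (hT : LinAlgGrp.IsMaximalTorus G T)
    {r : ℕ} (b : Module.Basis (Fin r) ℤ (LinAlgGrp.characterLattice T))
    (w : LinAlgGrp.WeylGroup G T) (_hw : LinAlgGrp.IsElliptic hT.isTorus w) :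
    (LinAlgGrp.fixedPoints hT.isTorus w).Finite ∧
    (LinAlgGrp.fixedPoints hT.isTorus w).ncard =
      LinAlgGrp.matrixMultiplicity K (LinAlgGrp.weylMatrix hT.isTorus w b - 1) ∧
    (LinAlgGrp.weylMatrix hT.isTorus w b - 1).det ≠ 0 ∧
    (CharZero K →
      LinAlgGrp.matrixMultiplicity K (LinAlgGrp.weylMatrix hT.isTorus w b - 1) =
        (LinAlgGrp.weylMatrix hT.isTorus w b - 1).det.natAbs) ∧
    (∀ p : ℕ, p.Prime → CharP K p →
      LinAlgGrp.matrixMultiplicity K (LinAlgGrp.weylMatrix hT.isTorus w b - 1) =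
        LinAlgGrp.primeToPart p (LinAlgGrp.weylMatrix hT.isTorus w b - 1).det.natAbs) := by
  have hC := LinAlgGrp.det_weylMatrix_sub_one_ne_zero hT.isTorus _hw b
  have e := LinAlgGrp.fixedPointsEquivKer hT.isTorus w b
  have := LinAlgGrp.finite_ker_torusHom K _ hC
  have hmult := LinAlgGrp.matrixMultiplicity_eq_card_ker K (LinAlgGrp.weylMatrix hT.isTorus w b - 1)
  refine ⟨Set.finite_coe_iff.1 (Finite.of_equiv _ e.symm), ?_, hC, fun _ => ?_, fun p hp _ => ?_⟩
  · rw [hmult, ← Nat.card_coe_set_eq, Nat.card_congr e]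
  · rw [hmult, LinAlgGrp.card_ker_torusHom K 1 _ hC, LinAlgGrp.primeToPart_one_left]
  · have : ExpChar K p := .prime hp
    rw [hmult, LinAlgGrp.card_ker_torusHom K p _ hC]
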